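/- Let $\mathcal H$ and $\mathcal G$ be real Hilbert spaces. For a set-valued operator $A$ on a Hilbert space, let $\operatorname{gra}A=\{(x,u): u\in Ax\}$, $\operatorname{dom}A=\{x: Ax\neq\varnothing\}$, $\operatorname{zer}A=\{x: 0\in Ax\}$, and let $A^{-1}$ be the operator with $x\in A^{-1}u\Leftrightarrow u\in Ax$. $A$ is monotone if $\langle x_1-x_2, u_1-u_2\rangle\ge 0$ for all $(x_1,u_1),(x_2,u_2)\in\operatorname{gra}A$, and maximally monotone if, moreover, its graph is not properly contained in the graph of another monotone operator. The normal cone operator of a set $C$ is given by $N_Cx=\{u:(\forall y\in C)\ \langle y-x,u\rangle\le 0\}$ if $x\in C$, and $N_Cx=\varnothing$ otherwise. For a bounded linear operator $L\colon\mathcal H\to\mathcal G$ and $B\colon\mathcal G\to2^{\mathcal G}$, the resolvent composition and the resolvent cocomposition are the set-valued operators on $\mathcal H$ $$L\mathbin{\triangleleft}B=\bigl(L^*\circ(B+\mathrm{Id}_{\mathcal G})^{-1}\circ L\bigr)^{-1}-\mathrm{Id}_{\mathcal H},\qquad L\mathbin{\triangleleft\!\triangleleft}B=\bigl(L\mathbin{\triangleleft}B^{-1}\bigr)^{-1}.$$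 A sequence $(A_n)_{n\in\mathbb N}$ of set-valued operators on $\mathcal H$ graph-converges to $A$, written $A_n\xrightarrow{g}A$, if $\operatorname{gra}A$ is equal both to the lower limit of $(\operatorname{gra}A_n)$, i.e. the set of limits of convergent sequences $(p_n)$ with $p_n\in\operatorname{gra}A_n$ for every $n$, and to its upper limit, i.e. the set of limits of convergent sequences $(p_n)$ with $p_n\in\operatorname{gra}A_{k_n}$ for every $n$, for some strictly increasing sequence $(k_n)$ in $\mathbb N$ (strong convergence in $\mathcal H\times\mathcal H$). Let $L_n$ ($n\in\mathbb N$) and $L$ be bounded linear operators from $\mathcal H$ to $\mathcal G$ such that $L_n\to L$ in operator norm and $\|L_n\|\le 1$ for every $n$, let $B\colon\mathcal G\to2^{\mathcal G}$ be maximally monotone, and let $(\gamma_n)_{n\in\mathbb N}$ be a sequence in $(0,\infty)$, not necessarily monotone. Then the following hold. (i) If $\gamma_n\to0$, then $$L_n\mathbin{\triangleleft}(\gamma_nB)\xrightarrow{g}L\mathbin{\triangleleft}N_{\overline{\operatorname{dom}}\,B}\quad\text{and}\quad L_n\mathbin{\triangleleft\!\triangleleft}(\gamma_nB)\xrightarrow{g}L\mathbin{\triangleleft\!\triangleleft}N_{\overline{\operatorname{dom}}\,B},$$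 where $\overline{\operatorname{dom}}\,B$ is the closure of $\operatorname{dom}B$. (ii) If $\gamma_n\to+\infty$ and $\operatorname{zer}B\neq\varnothing$, then $$L_n\mathbin{\triangleleft}(\gamma_nB)\xrightarrow{g}L\mathbin{\triangleleft}N_{\operatorname{zer}B}\quad\text{and}\quad L_n\mathbin{\triangleleft\!\triangleleft}(\gamma_nB)\xrightarrow{g}L\mathbin{\triangleleft\!\triangleleft}N_{\operatorname{zer}B}.$$ -/

import Mathlib

open Filter Topology
open scoped Pointwise

namespace SetValuedOp

variable {H G : Type*}

/-- The domain `{x | A x ≠ ∅}` of a set-valued operator. -/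
def dom (A : H → Set H) : Set H := {x | (A x).Nonempty}

/-- The graph `{(x, u) | u ∈ A x}` of a set-valued operator. -/
def graph (A : H → Set H) : Set (H × H) := {p | p.2 ∈ A p.1}

/-- The zeros `{x | 0 ∈ A x}` of a set-valued operator. -/
def zer [Zero H] (A : H → Set H) : Set H := {x | (0 : H) ∈ A x}

/-- The inverse of a set-valued operator: `x ∈ A⁻¹ u` if and only if `u ∈ A x`. -/
def inverse (A : H → Set H) : H → Set H := fun u => {x | u ∈ A x}

/-- The lower limit of a sequence of sets, in the sense of Painlevé and Kuratowski. -/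
def lowerLimit {X : Type*} [TopologicalSpace X] (C : ℕ → Set X) : Set X :=
  {x | ∃ u : ℕ → X, (∀ n, u n ∈ C n) ∧ Tendsto u atTop (𝓝 x)}

/-- The upper limit of a sequence of sets, in the sense of Painlevé and Kuratowski:
the limits of sequences drawn from a subsequence of the sets. -/
def upperLimit {X : Type*} [TopologicalSpace X] (C : ℕ → Set X) : Set X :=
  {x | ∃ (u : ℕ → X) (k : ℕ → ℕ), StrictMono k ∧ (∀ n, u n ∈ C (k n)) ∧ Tendsto u atTop (𝓝 x)}

/-- Graph-convergence: the graphs converge in the sense of Painlevé and Kuratowski. -/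
def GraphConverges [TopologicalSpace H] (A : ℕ → H → Set H) (A' : H → Set H) : Prop :=
  lowerLimit (fun n => graph (A n)) = graph A' ∧ upperLimit (fun n => graph (A n)) = graph A'

variable [NormedAddCommGroup H] [InnerProductSpace ℝ H]
  [NormedAddCommGroup G] [InnerProductSpace ℝ G]

/-- Monotone set-valued operators. -/
def IsMonotone (A : H → Set H) : Prop :=
  ∀ p ∈ graph A, ∀ q ∈ graph A, 0 ≤ inner ℝ (p.1 - q.1) (p.2 - q.2)

/-- Maximally monotone set-valued operators. -/
def IsMaximallyMonotone (A : H → Set H) : Prop :=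
  IsMonotone A ∧ ¬ ∃ A' : H → Set H, IsMonotone A' ∧ graph A ⊂ graph A'

/-- The normal cone operator of a set `C` (empty-valued outside `C`). -/
def normalCone (C : Set H) : H → Set H :=
  fun x => {u | x ∈ C ∧ ∀ y ∈ C, inner ℝ (y - x) u ≤ 0}

variable [CompleteSpace H] [CompleteSpace G]

/-- The parallel composition `(S ∘ A⁻¹ ∘ S*)⁻¹` of `A` by the bounded linear operator `S`. -/
noncomputable def parallelComp (S : G →L[ℝ] H) (A : G → Set G) : H → Set H :=
  inverse (fun x => S '' inverse A (ContinuousLinearMap.adjoint S x))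

/-- The resolvent composition of `B` and `L` with parameter `γ`, that is, the parallel
composition of `B + γ⁻¹ Id` by `L*`, minus `γ⁻¹ Id`. -/
noncomputable def resolventComp (γ : ℝ) (L : H →L[ℝ] G) (B : G → Set G) : H → Set H :=
  fun x => parallelComp (ContinuousLinearMap.adjoint L) (fun y => B y + {γ⁻¹ • y}) x - {γ⁻¹ • x}

/-- The resolvent cocomposition of `B` and `L` with parameter `γ`. -/
noncomputable def resolventCocomp (γ : ℝ) (L : H →L[ℝ] G) (B : G → Set G) : H → Set H :=
  inverse (resolventComp (1 / γ) L (inverse B))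

end SetValuedOp

/-! If `M` has resolvent `J`, then `(x, v)` lies in the graph of `L ◁ M` exactly when `x = L* J (L
(x + v))`. Since resolvents are nonexpansive and `Ln → L` in norm, pointwise convergence of the
resolvents gives convergence of the maps `Ln* Jn Ln` along convergent arguments, hence graph
convergence (`graphConverges_resolventComp`). Cocompositions follow because `M⁻¹` has resolvent `Id
- J` and graph convergence survives inversion.

It remains to show that the resolvents of `γ n • B` exist (Minty, via Debrunner–Flor) and converge
pointwise to the projection onto `closure (dom B)` as `γ → 0`, or onto `zer B` as `γ → ∞`. These
projections are resolvents of the normal cones. -/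

namespace SetValuedOp

/-! ### Resolvents and graph convergence of compositions. -/

section Resolvent

variable {H G : Type*} [NormedAddCommGroup H] [InnerProductSpace ℝ H]
  [NormedAddCommGroup G] [InnerProductSpace ℝ G]

/-- `J` is the single-valued, everywhere defined resolvent `(M + Id)⁻¹` of `M`. -/
def IsResolvent (M : G → Set G) (J : G → G) : Prop :=
  ∀ y r, y - r ∈ M r ↔ r = J y

omit [InnerProductSpace ℝ G] in
theorem IsResolvent.inverse {M : G → Set G} {J : G → G} (h : IsResolvent M J) :
    IsResolvent (inverse M) (fun y => y - J y) := by
  intro y r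
  have := h y (y - r)
  rw [sub_sub_cancel] at this
  change r ∈ M (y - r) ↔ _
  rw [this]
  rw [sub_eq_iff_eq_add, eq_sub_iff_add_eq, add_comm, eq_comm]

theorem IsMonotone.inverse {M : G → Set G} (h : IsMonotone M) : IsMonotone (inverse M) := by
  intro p hp q hq
  have := h (p.2, p.1) hp (q.2, q.1) hq
  rwa [real_inner_comm] at this

theorem IsMonotone.smul {M : G → Set G} (h : IsMonotone M) {c : ℝ} (hc : 0 ≤ c) :
    IsMonotone (fun y => c • M y) := by
  rintro ⟨x, _⟩ ⟨u, hu, rfl⟩ ⟨y, _⟩ ⟨v, hv, rfl⟩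
  have h1 : 0 ≤ inner ℝ (x - y) (u - v) := h (x, u) hu (y, v) hv
  change 0 ≤ inner ℝ (x - y) (c • u - c • v)
  rw [← smul_sub, inner_smul_right]
  positivity

theorem isMonotone_normalCone (C : Set G) : IsMonotone (normalCone C) := by
  rintro ⟨x, u⟩ ⟨hx, hu⟩ ⟨y, v⟩ ⟨hy, hv⟩
  have h1 : inner ℝ (y - x) u ≤ 0 := hu y hy
  have h2 : inner ℝ (x - y) v ≤ 0 := hv x hx
  change 0 ≤ inner ℝ (x - y) (u - v)
  rw [← neg_sub x y, inner_neg_left] at h1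
  rw [inner_sub_right]
  linarith

/-- Only uniqueness needs proof: monotonicity applied to two candidates `r` and `J y` gives `-‖r - J
y‖² ≥ 0`. -/
theorem IsMonotone.isResolvent {M : G → Set G} (h : IsMonotone M) {J : G → G}
    (hJ : ∀ y, y - J y ∈ M (J y)) : IsResolvent M J := by
  intro y r
  refine ⟨fun hr => ?_, fun hr => hr ▸ hJ y⟩
  have h1 : 0 ≤ inner ℝ (r - J y) ((y - r) - (y - J y)) := h (r, y - r) hr (J y, y - J y) (hJ y)
  rw [sub_sub_sub_cancel_left, ← neg_sub r, inner_neg_right, real_inner_self_eq_norm_sq] at h1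
  have h2 : ‖r - J y‖ = 0 := by nlinarith [norm_nonneg (r - J y)]
  exact sub_eq_zero.mp (norm_eq_zero.mp h2)

omit [InnerProductSpace ℝ G] in
theorem IsResolvent.mem {M : G → Set G} {J : G → G} (hJ : IsResolvent M J) (y : G) :
    y - J y ∈ M (J y) := (hJ y (J y)).mpr rfl

theorem IsResolvent.norm_sub_le {M : G → Set G} {J : G → G} (hJ : IsResolvent M J)
    (h : IsMonotone M) (x y : G) : ‖J x - J y‖ ≤ ‖x - y‖ := by
  have h1 : 0 ≤ inner ℝ (J x - J y) ((x - J x) - (y - J y)) :=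
    h (J x, x - J x) (hJ.mem x) (J y, y - J y) (hJ.mem y)
  rw [sub_sub_sub_comm, inner_sub_right, real_inner_self_eq_norm_sq] at h1
  have h2 := real_inner_le_norm (J x - J y) (x - y)
  by_contra! hlt
  nlinarith [norm_nonneg (x - y)]

variable [CompleteSpace H] [CompleteSpace G]

theorem mem_graph_resolventComp {M : G → Set G} {J : G → G} (hJ : IsResolvent M J)
    (L : H →L[ℝ] G) (p : H × H) :
    p ∈ graph (resolventComp 1 L M) ↔ p.1 = L.adjoint (J (L (p.1 + p.2))) := by
  obtain ⟨x, v⟩ := p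
  simp only [graph, resolventComp, parallelComp, inverse, Set.mem_ofPred_eq, Set.mem_image,
    Set.sub_singleton, Set.add_singleton, inv_one, one_smul,
    ContinuousLinearMap.adjoint_adjoint]
  have key : ∀ y r, (∃ w ∈ M r, w + r = y) ↔ r = J y := by
    intro y r
    rw [← hJ y r]
    constructor
    · rintro ⟨w, hw, rfl⟩; simpa using hw
    · intro h; exact ⟨_, h, by simp⟩
  constructor
  · rintro ⟨u, ⟨r, hr, hx⟩, rfl⟩
    rw [key] at hr
    simp [← hr, hx]
  · intro h
    exact ⟨x + v, ⟨J (L (x + v)), (key _ _).mpr rfl, h.symm⟩, by simp⟩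

theorem lowerLimit_subset_upperLimit {X : Type*} [TopologicalSpace X] (C : ℕ → Set X) :
    lowerLimit C ⊆ upperLimit C := by
  rintro x ⟨u, hu, hx⟩
  exact ⟨u, id, strictMono_id, hu, hx⟩

theorem graphConverges_of_subset {X : Type*} [TopologicalSpace X] {A : ℕ → X → Set X}
    {A' : X → Set X} (h1 : graph A' ⊆ lowerLimit (fun n => graph (A n)))
    (h2 : upperLimit (fun n => graph (A n)) ⊆ graph A') : GraphConverges A A' :=
  ⟨((lowerLimit_subset_upperLimit _).trans h2).antisymm h1,
    h2.antisymm (h1.trans (lowerLimit_subset_upperLimit _))⟩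

theorem GraphConverges.inverse {X : Type*} [TopologicalSpace X] {A : ℕ → X → Set X}
    {A' : X → Set X} (h : GraphConverges A A') :
    GraphConverges (fun n => inverse (A n)) (inverse A') := by
  apply graphConverges_of_subset
  · rintro p (hp : p.swap ∈ graph A')
    rw [← h.1] at hp
    obtain ⟨u, hu, hlim⟩ := hp
    exact ⟨fun n => (u n).swap, hu, (continuous_swap.tendsto p.swap).comp hlim⟩
  · rintro p ⟨u, k, hk, hu, hlim⟩
    change p.swap ∈ graph A'
    rw [← h.2]
    exact ⟨fun n => (u n).swap, k, hk, hu, (continuous_swap.tendsto _).comp hlim⟩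

omit [InnerProductSpace ℝ G] [CompleteSpace G] in
/-- Nonexpansive maps converging pointwise converge continuously. -/
theorem tendsto_apply_of_norm_sub_le {ι : Type*} {l : Filter ι} {T : ι → G → G} {T' : G → G}
    (hT : ∀ i x y, ‖T i x - T i y‖ ≤ ‖x - y‖) (hlim : ∀ x, Tendsto (fun i => T i x) l (𝓝 (T' x)))
    {u : ι → G} {x : G} (hu : Tendsto u l (𝓝 x)) :
    Tendsto (fun i => T i (u i)) l (𝓝 (T' x)) := by
  have h1 : Tendsto (fun i => T i (u i) - T i x) l (𝓝 0) :=
    squeeze_zero_norm (fun i => hT i _ _) (tendsto_iff_norm_sub_tendsto_zero.mp hu)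
  simpa using h1.add (hlim x)

omit [CompleteSpace H] [CompleteSpace G] in
theorem tendsto_clm_apply {ι : Type*} {l : Filter ι} {T : ι → H →L[ℝ] G} {T' : H →L[ℝ] G}
    {u : ι → H} {x : H} (hT : Tendsto T l (𝓝 T')) (hu : Tendsto u l (𝓝 x)) :
    Tendsto (fun i => T i (u i)) l (𝓝 (T' x)) :=
  ((isBoundedBilinearMap_apply (𝕜 := ℝ) (E := H) (F := G)).continuous.tendsto (T', x)).comp
    (hT.prodMk_nhds hu)

theorem graphConverges_resolventComp {Ln : ℕ → H →L[ℝ] G} {L : H →L[ℝ] G}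
    {M : ℕ → G → Set G} {M' : G → Set G} {J : ℕ → G → G} {J' : G → G}
    (hL : Tendsto Ln atTop (𝓝 L))
    (hM : ∀ n, IsMonotone (M n)) (hJ : ∀ n, IsResolvent (M n) (J n)) (hJ' : IsResolvent M' J')
    (hlim : ∀ x, Tendsto (fun n => J n x) atTop (𝓝 (J' x))) :
    GraphConverges (fun n => resolventComp 1 (Ln n) (M n)) (resolventComp 1 L M') := by
  have hadj : Tendsto (fun n => (Ln n).adjoint) atTop (𝓝 L.adjoint) :=
    (ContinuousLinearMap.adjoint.continuous.tendsto L).comp hL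
  have key : ∀ (k : ℕ → ℕ), Tendsto k atTop atTop → ∀ (u : ℕ → H) (x : H),
      Tendsto u atTop (𝓝 x) →
      Tendsto (fun n => (Ln (k n)).adjoint (J (k n) (Ln (k n) (u n)))) atTop
        (𝓝 (L.adjoint (J' (L x)))) := by
    intro k hk u x hu
    have h1 : Tendsto (fun n => Ln (k n) (u n)) atTop (𝓝 (L x)) := tendsto_clm_apply (hL.comp hk) hu
    have h2 := tendsto_apply_of_norm_sub_le (T := fun n => J (k n))
      (fun n => (hJ (k n)).norm_sub_le (hM (k n))) (fun y => (hlim y).comp hk) h1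
    exact tendsto_clm_apply (hadj.comp hk) h2
  apply graphConverges_of_subset
  · rintro ⟨x, v⟩ hp
    rw [mem_graph_resolventComp hJ'] at hp
    have h1 := key id tendsto_id (fun _ => x + v) (x + v) tendsto_const_nhds
    -- Minty parametrization: the sum `x + v` is kept fixed and split along the graph of the `n`-th
    -- operator.
    refine ⟨fun n => ((Ln n).adjoint (J n (Ln n (x + v))),
      x + v - (Ln n).adjoint (J n (Ln n (x + v)))), fun n => ?_, ?_⟩
    · rw [mem_graph_resolventComp (hJ n)]
      simp
    · have h2 : Tendsto (fun n => (Ln n).adjoint (J n (Ln n (x + v)))) atTop (𝓝 x) := by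
        conv_rhs => rw [show x = _ from hp]
        exact h1
      have h3 := h2.const_sub (x + v)
      rw [add_sub_cancel_left] at h3
      exact h2.prodMk_nhds h3
  · rintro ⟨x, v⟩ ⟨u, k, hk, hu, hlim'⟩
    rw [mem_graph_resolventComp hJ']
    have h1 : Tendsto (fun n => (u n).1) atTop (𝓝 x) := (continuous_fst.tendsto _).comp hlim'
    have h2 : Tendsto (fun n => (u n).2) atTop (𝓝 v) := (continuous_snd.tendsto _).comp hlim'
    have h3 := key k hk.tendsto_atTop _ _ (h1.add h2)
    refine tendsto_nhds_unique h1 (h3.congr fun n => ?_)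
    exact ((mem_graph_resolventComp (hJ (k n)) _ _).mp (hu n)).symm

theorem graphConverges_resolventCocomp {Ln : ℕ → H →L[ℝ] G} {L : H →L[ℝ] G}
    {M : ℕ → G → Set G} {M' : G → Set G} {J : ℕ → G → G} {J' : G → G}
    (hL : Tendsto Ln atTop (𝓝 L))
    (hM : ∀ n, IsMonotone (M n)) (hJ : ∀ n, IsResolvent (M n) (J n)) (hJ' : IsResolvent M' J')
    (hlim : ∀ x, Tendsto (fun n => J n x) atTop (𝓝 (J' x))) :
    GraphConverges (fun n => resolventCocomp 1 (Ln n) (M n)) (resolventCocomp 1 L M') := by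
  have h := graphConverges_resolventComp hL (fun n => (hM n).inverse) (fun n => (hJ n).inverse)
    hJ'.inverse (fun x => (hlim x).const_sub x)
  simpa only [resolventCocomp, div_one] using h.inverse

end Resolvent

/-! ### Debrunner–Flor lemma and Minty's theorem. -/

section Minty

variable {G : Type*} [NormedAddCommGroup G] [InnerProductSpace ℝ G]

/-- The finite case of the Debrunner–Flor lemma. -/
theorem exists_inner_le_zero_of_finite {ι : Type*} [Fintype ι] (y v : ι → G)
    (hmono : ∀ i j, 0 ≤ inner ℝ (y i - y j) (v i - v j)) :
    ∃ x : G, ∀ i, inner ℝ (x - y i) (x + v i) ≤ 0 := by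
  classical
  rcases isEmpty_or_nonempty ι with hι | hι
  · exact ⟨0, fun i => hι.elim i⟩
  let c : (ι → ℝ) → G := fun l => ∑ i, l i • ((1 / 2 : ℝ) • (y i - v i))
  let s : (ι → ℝ) → ℝ := fun l => ∑ i, l i * inner ℝ (y i) (v i)
  have hc : Continuous c := by fun_prop
  have hs : Continuous s := by fun_prop
  -- At a minimizer, optimality toward vertex `i` reads `⟪x - y i, x + v i⟫ ≤ -(‖x‖² + s l)`, so it
  -- suffices that the minimum be nonnegative.
  obtain ⟨l, hl, hmin⟩ := (isCompact_stdSimplex ℝ ι).exists_isMinOn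
    ⟨_, single_mem_stdSimplex ℝ (Classical.arbitrary ι)⟩
    (f := fun l => ‖c l‖ ^ 2 + s l) (by fun_prop)
  obtain ⟨hl0, hl1⟩ := hl
  set x := c l with hx
  -- Averaging the monotonicity inequalities gives `s l ≥ ⟪Y, V⟫`; the sum is then at least `‖Y +
  -- V‖² / 4`.
  have hneg : 0 ≤ ‖x‖ ^ 2 + s l := by
    set Y := ∑ i, l i • y i with hY
    set V := ∑ i, l i • v i with hV
    have hxe : x = (1 / 2 : ℝ) • (Y - V) := by
      simp only [hx, c, hY, hV, ← Finset.sum_sub_distrib, Finset.smul_sum, ← smul_sub]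
      exact Finset.sum_congr rfl fun i _ => smul_comm _ _ _
    have hdouble : 0 ≤ ∑ i, ∑ j, l i * (l j * inner ℝ (y i - y j) (v i - v j)) :=
      Finset.sum_nonneg fun i _ => Finset.sum_nonneg fun j _ =>
        mul_nonneg (hl0 i) (mul_nonneg (hl0 j) (hmono i j))
    have hYV : ∑ i, ∑ j, l i * (l j * inner ℝ (y i) (v j)) = inner ℝ Y V := by
      simp only [hY, hV, sum_inner, inner_sum, inner_smul_left, inner_smul_right]
      rw [Finset.sum_comm]
      refine Finset.sum_congr rfl fun i _ => ?_
      rw [Finset.mul_sum]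
      refine Finset.sum_congr rfl fun j _ => ?_
      simp only [conj_trivial]
      ring
    have hYV' : ∑ i, ∑ j, l i * (l j * inner ℝ (y j) (v i)) = inner ℝ Y V := by
      rw [← hYV, Finset.sum_comm]
      exact Finset.sum_congr rfl fun i _ => Finset.sum_congr rfl fun j _ => by ring
    have hs1 : ∑ i, ∑ j, l i * (l j * inner ℝ (y i) (v i)) = s l := by
      refine Finset.sum_congr rfl fun i _ => ?_
      rw [← Finset.mul_sum, ← Finset.sum_mul, hl1, one_mul]
    have hs2 : ∑ i, ∑ j, l i * (l j * inner ℝ (y j) (v j)) = s l := by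
      rw [← hs1, Finset.sum_comm]
      exact Finset.sum_congr rfl fun i _ => Finset.sum_congr rfl fun j _ => by ring
    have hexp : ∑ i, ∑ j, l i * (l j * inner ℝ (y i - y j) (v i - v j))
        = s l - inner ℝ Y V - inner ℝ Y V + s l := by
      conv_rhs => rw [← hs2]
      conv_rhs => enter [1, 1, 1]; rw [hs2, ← hs1]
      conv_rhs => enter [1, 2]; rw [← hYV']
      conv_rhs => enter [1, 1, 2]; rw [← hYV]
      simp only [← Finset.sum_sub_distrib, ← Finset.sum_add_distrib]
      refine Finset.sum_congr rfl fun i _ => Finset.sum_congr rfl fun j _ => ?_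
      simp only [inner_sub_left, inner_sub_right]
      ring
    rw [hexp] at hdouble
    have h3 : ‖x‖ ^ 2 = (1 / 4) * ‖Y - V‖ ^ 2 := by
      rw [hxe, norm_smul, mul_pow]; norm_num
    have h4 := norm_sub_sq_real Y V
    have h5 := norm_add_sq_real Y V
    nlinarith [sq_nonneg ‖Y + V‖]
  refine ⟨x, fun i => ?_⟩
  set d := (1 / 2 : ℝ) • (y i - v i) - x with hd
  set e := inner ℝ (y i) (v i) - s l with he
  have hvar : ∀ t : ℝ, 0 < t → t ≤ 1 → 0 ≤ (2 * inner ℝ x d + e) + t * ‖d‖ ^ 2 := by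
    intro t ht ht1
    let m : ι → ℝ := (1 - t) • l + t • Pi.single i 1
    have hm : m ∈ stdSimplex ℝ ι :=
      convex_stdSimplex ℝ ι ⟨hl0, hl1⟩ (single_mem_stdSimplex ℝ i) (by linarith) ht.le (by ring)
    have hcm : c m = x + t • d := by
      simp only [c, m, Pi.add_apply, Pi.smul_apply, smul_eq_mul, add_smul, mul_smul,
        Finset.sum_add_distrib, ← Finset.smul_sum]
      rw [show ∑ j, (Pi.single i 1 : ι → ℝ) j • ((1 / 2 : ℝ) • (y j - v j))
        = (1 / 2 : ℝ) • (y i - v i) by simp [Pi.single_apply, ite_smul]]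
      change (1 - t) • x + _ = _
      rw [hd]
      module
    have hsm : s m = s l + t * e := by
      simp only [s, m, Pi.add_apply, Pi.smul_apply, smul_eq_mul, add_mul, mul_assoc,
        Finset.sum_add_distrib, ← Finset.mul_sum]
      rw [show ∑ j, (Pi.single i 1 : ι → ℝ) j * inner ℝ (y j) (v j) = inner ℝ (y i) (v i) by
        simp [Pi.single_apply]]
      ring
    have h1 : ‖x‖ ^ 2 + s l ≤ ‖c m‖ ^ 2 + s m := hmin hm
    rw [hcm, hsm, norm_add_sq_real, inner_smul_right, norm_smul, mul_pow, Real.norm_eq_abs,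
      sq_abs] at h1
    have h2 : 0 ≤ t * ((2 * inner ℝ x d + e) + t * ‖d‖ ^ 2) := by linarith
    exact nonneg_of_mul_nonneg_right h2 ht
  have hder : 0 ≤ 2 * inner ℝ x d + e := by
    have hlim : Tendsto (fun t : ℝ => (2 * inner ℝ x d + e) + t * ‖d‖ ^ 2) (𝓝[>] 0)
        (𝓝 ((2 * inner ℝ x d + e) + 0 * ‖d‖ ^ 2)) :=
      (Continuous.tendsto (by fun_prop) _).mono_left nhdsWithin_le_nhds
    rw [zero_mul, add_zero] at hlim
    refine ge_of_tendsto hlim ?_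
    filter_upwards [Ioc_mem_nhdsGT (zero_lt_one' ℝ)] with t ht using hvar t ht.1 ht.2
  have h6 : inner ℝ (x - y i) (x + v i)
      = ‖x‖ ^ 2 - (inner ℝ x (y i) - inner ℝ x (v i)) - inner ℝ (y i) (v i) := by
    rw [inner_sub_left, inner_add_right, inner_add_right, real_inner_self_eq_norm_sq,
      real_inner_comm x (y i)]
    ring
  have h7 : inner ℝ x d = (1 / 2) * (inner ℝ x (y i) - inner ℝ x (v i)) - ‖x‖ ^ 2 := by
    rw [hd, inner_sub_right, inner_smul_right, inner_sub_right, real_inner_self_eq_norm_sq]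
  rw [h6]
  linarith

/-- Completing the square turns each constraint into a closed ball with diameter from `y` to `-v`,
which is weak* compact after Riesz identification. -/
theorem inner_sub_add_le_zero_iff (x y v : G) :
    inner ℝ (x - y) (x + v) ≤ 0 ↔ ‖x - (1 / 2 : ℝ) • (y - v)‖ ≤ ‖(1 / 2 : ℝ) • (y + v)‖ := by
  have h : inner ℝ (x - y) (x + v)
      = ‖x - (1 / 2 : ℝ) • (y - v)‖ ^ 2 - ‖(1 / 2 : ℝ) • (y + v)‖ ^ 2 := by
    have e1 : x - y = (x - (1 / 2 : ℝ) • (y - v)) - (1 / 2 : ℝ) • (y + v) := by module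
    have e2 : x + v = (x - (1 / 2 : ℝ) • (y - v)) + (1 / 2 : ℝ) • (y + v) := by module
    rw [e1, e2, inner_sub_left, inner_add_right, inner_add_right, real_inner_self_eq_norm_sq,
      real_inner_self_eq_norm_sq, real_inner_comm]
    ring
  rw [h, sub_nonpos, sq_le_sq₀ (norm_nonneg _) (norm_nonneg _)]

variable [CompleteSpace G]

/-- The Debrunner–Flor lemma for a monotone subset of `G × G`. -/
theorem exists_inner_le_zero {S : Set (G × G)}
    (hS : ∀ p ∈ S, ∀ q ∈ S, 0 ≤ inner ℝ (p.1 - q.1) (p.2 - q.2)) :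
    ∃ x : G, ∀ p ∈ S, inner ℝ (x - p.1) (x + p.2) ≤ 0 := by
  rcases S.eq_empty_or_nonempty with rfl | ⟨p₀, hp₀⟩
  · exact ⟨0, by simp⟩
  let D := InnerProductSpace.toDual ℝ G
  let K : S → Set (WeakDual ℝ G) := fun p => WeakDual.toStrongDual ⁻¹'
    Metric.closedBall (D ((1 / 2 : ℝ) • (p.1.1 - p.1.2))) ‖(1 / 2 : ℝ) • (p.1.1 + p.1.2)‖
  have hK : ∀ (p : S) (x : G),
      StrongDual.toWeakDual (D x) ∈ K p ↔ inner ℝ (x - p.1.1) (x + p.1.2) ≤ 0 := by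
    intro p x
    rw [inner_sub_add_le_zero_iff]
    change D x ∈ Metric.closedBall _ _ ↔ _
    rw [Metric.mem_closedBall, dist_eq_norm, ← map_sub, LinearIsometryEquiv.norm_map]
  have hcpt : ∀ p, IsCompact (K p) := fun p => WeakDual.isCompact_closedBall _ _
  obtain ⟨f, -, hf⟩ := (hcpt ⟨p₀, hp₀⟩).inter_iInter_nonempty K
    (fun p => (hcpt p).isClosed) (by
      intro t
      classical
      obtain ⟨x, hx⟩ := exists_inner_le_zero_of_finite
        (ι := ↥(insert (⟨p₀, hp₀⟩ : S) t)) (fun i => i.1.1.1) (fun i => i.1.1.2)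
        (fun i j => hS _ i.1.2 _ j.1.2)
      refine ⟨StrongDual.toWeakDual (D x), (hK _ _).mpr (hx ⟨_, Finset.mem_insert_self _ _⟩), ?_⟩
      simp only [Set.mem_iInter]
      exact fun p hp => (hK _ _).mpr (hx ⟨p, Finset.mem_insert_of_mem hp⟩))
  refine ⟨D.symm (WeakDual.toStrongDual f), fun p hp => (hK ⟨p, hp⟩ _).mp ?_⟩
  have := Set.mem_iInter.mp hf ⟨p, hp⟩
  simpa using this

-- Otherwise adjoining `(x, u)` to the graph would give a proper monotone extension.
omit [CompleteSpace G] in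
theorem IsMaximallyMonotone.mem {B : G → Set G} (hB : IsMaximallyMonotone B) {x u : G}
    (h : ∀ y, ∀ v ∈ B y, 0 ≤ inner ℝ (x - y) (u - v)) : u ∈ B x := by
  by_contra hu
  refine hB.2 ⟨fun y => {v | v ∈ B y ∨ (y = x ∧ v = u)}, ?_, ?_⟩
  · rintro ⟨a, b⟩ (hab | ⟨rfl, rfl⟩) ⟨c, d⟩ (hcd | ⟨rfl, rfl⟩)
    · exact hB.1 _ hab _ hcd
    · have := h a b hab
      rw [← neg_sub, ← neg_sub b, inner_neg_neg] at this
      exact this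
    · exact h c d hcd
    · simp
  · refine ⟨fun p hp => Or.inl hp, fun hsub => hu ?_⟩
    exact hsub (show (x, u) ∈ graph _ from Or.inr ⟨rfl, rfl⟩)

/-- Minty's theorem: a positive multiple of a maximally monotone operator has a full-domain
resolvent. -/
theorem IsMaximallyMonotone.exists_sub_mem {B : G → Set G} (hB : IsMaximallyMonotone B) {c : ℝ}
    (hc : 0 < c) (z : G) : ∃ x, c⁻¹ • (z - x) ∈ B x := by
  -- The shift by `z` preserves monotonicity and makes the resulting inequality say that `(x, c⁻¹ •
  -- (z - x))` is monotonically related to the graph of `B`.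
  obtain ⟨x, hx⟩ := exists_inner_le_zero (S := (fun p : G × G => (p.1, c • p.2 - z)) '' graph B) (by
    rintro _ ⟨p, hp, rfl⟩ _ ⟨q, hq, rfl⟩
    have := hB.1 p hp q hq
    rw [sub_sub_sub_cancel_right, ← smul_sub, inner_smul_right]
    positivity)
  refine ⟨x, hB.mem fun y v hv => ?_⟩
  have h1 : inner ℝ (x - y) (x + (c • v - z)) ≤ 0 := hx _ ⟨(y, v), hv, rfl⟩
  have h2 : c⁻¹ • (z - x) - v = (-c⁻¹) • (x + (c • v - z)) := by
    have h3 : v = c⁻¹ • (c • v) := by rw [smul_smul, inv_mul_cancel₀ hc.ne', one_smul]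
    conv_lhs => rw [h3]
    module
  rw [h2, inner_smul_right]
  have := inv_pos.mpr hc
  nlinarith

end Minty

/-! ### Limits of resolvents as the parameter tends to zero or infinity. -/

section Asymptotics

variable {G : Type*} [NormedAddCommGroup G] [InnerProductSpace ℝ G] [CompleteSpace G]

/-- A set between `dom B` and its closed convex hull (for maximally monotone `B`). -/
def quasiDom (B : G → Set G) : Set G :=
  {y | ∃ c : ℝ, 0 ≤ c ∧ ∀ x, ∀ w ∈ B x, -(c * (1 + ‖x‖)) ≤ inner ℝ (x - y) w}

-- The defining bound is affine in `y`. This allows projecting without first proving that `closure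
-- (dom B)` is convex.
omit [CompleteSpace G] in
theorem convex_quasiDom (B : G → Set G) : Convex ℝ (quasiDom B) := by
  rintro y ⟨c, hc, h⟩ y' ⟨c', hc', h'⟩ a b ha hb hab
  refine ⟨a * c + b * c', by positivity, fun x w hw => ?_⟩
  have e : x - (a • y + b • y') = a • (x - y) + b • (x - y') := by
    obtain rfl : b = 1 - a := by linarith
    module
  rw [e, inner_add_left, real_inner_smul_left, real_inner_smul_left]
  nlinarith [mul_le_mul_of_nonneg_left (h x w hw) ha, mul_le_mul_of_nonneg_left (h' x w hw) hb]

omit [CompleteSpace G] in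
theorem IsMonotone.dom_subset_quasiDom {B : G → Set G} (hB : IsMonotone B) :
    dom B ⊆ quasiDom B := by
  rintro y ⟨v, hv⟩
  refine ⟨‖v‖ * (1 + ‖y‖), by positivity, fun x w hw => ?_⟩
  have h1 : 0 ≤ inner ℝ (x - y) (w - v) := hB (x, w) hw (y, v) hv
  rw [inner_sub_right] at h1
  have h2 := neg_le_of_abs_le (abs_real_inner_le_norm (x - y) v)
  have h3 : ‖x - y‖ * ‖v‖ ≤ ‖v‖ * (1 + ‖y‖) * (1 + ‖x‖) := by
    rw [mul_comm ‖x - y‖, mul_assoc]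
    refine mul_le_mul_of_nonneg_left ?_ (norm_nonneg v)
    nlinarith [norm_sub_le x y, mul_nonneg (norm_nonneg x) (norm_nonneg y)]
  linarith

/-- Resolvents `(Id + γ B)⁻¹ z` converge to the projection of `z` onto the closure of `dom B`
as `γ → 0`. -/
theorem IsMonotone.exists_tendsto_resolvent_zero {B : G → Set G} (hB : IsMonotone B) {γ : ℕ → ℝ}
    (hγ : ∀ n, 0 < γ n) (hlim : Tendsto γ atTop (𝓝 0)) (z : G) {x : ℕ → G}
    (hx : ∀ n, (γ n)⁻¹ • (z - x n) ∈ B (x n)) :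
    ∃ p, z - p ∈ normalCone (closure (dom B)) p ∧ Tendsto x atTop (𝓝 p) := by
  have hdom : ∀ n, x n ∈ dom B := fun n => ⟨_, hx n⟩
  -- The projection is onto the possibly larger `closure (quasiDom B)`; since `x n` lies in `dom B`,
  -- its limit `p` falls in `closure (dom B)`.
  obtain ⟨p, hpD, hp⟩ := exists_norm_eq_iInf_of_complete_convex
    (K := closure (quasiDom B)) ⟨x 0, subset_closure (hB.dom_subset_quasiDom (hdom 0))⟩
    isClosed_closure.isComplete (convex_quasiDom B).closure z
  rw [norm_eq_iInf_iff_real_inner_le_zero (convex_quasiDom B).closure hpD] at hp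
  have hconv : Tendsto x atTop (𝓝 p) := by
    rw [Metric.tendsto_atTop']
    intro ε hε
    set K := 2 + ‖p‖ + ‖z - p‖ with hK
    have hKpos : 0 < K := by positivity
    -- Chosen so that the final estimate `a ^ 2 ≤ 2 * δ * a + δ * K` is incompatible with `a ≥ ε`.
    obtain ⟨δ, hδ, hδ1, hδε⟩ : ∃ δ : ℝ, 0 < δ ∧ δ ≤ ε / 4 ∧ 4 * (δ * K) ≤ ε ^ 2 / 2 := by
      refine ⟨min (ε / 4) (ε ^ 2 / (8 * K)), by positivity, min_le_left _ _, ?_⟩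
      have h1 : min (ε / 4) (ε ^ 2 / (8 * K)) * K ≤ ε ^ 2 / (8 * K) * K :=
        mul_le_mul_of_nonneg_right (min_le_right _ _) hKpos.le
      have h2 : ε ^ 2 / (8 * K) * K = ε ^ 2 / 8 := by field_simp
      linarith
    obtain ⟨y, ⟨c, hc, hy⟩, hyp⟩ := Metric.mem_closure_iff.mp hpD δ hδ
    have hγc : Tendsto (fun n => γ n * c) atTop (𝓝 0) := by simpa using hlim.mul_const c
    obtain ⟨N, hN⟩ := eventually_atTop.mp (hγc.eventually_lt_const hδ)
    refine ⟨N, fun n hn => ?_⟩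
    have hn' := (hN n hn.le).le
    rw [dist_eq_norm]
    set a := ‖x n - p‖ with ha
    have ha0 : 0 ≤ a := norm_nonneg _
    have i1 : inner ℝ (z - p) (x n - p) ≤ 0 :=
      hp _ (subset_closure (hB.dom_subset_quasiDom (hdom n)))
    have i2 : inner ℝ (x n - y) (x n - z) ≤ γ n * c * (1 + ‖x n‖) := by
      have h1 := hy _ _ (hx n)
      rw [inner_smul_right] at h1
      have h2 := mul_le_mul_of_nonneg_left h1 (hγ n).le
      rw [← mul_assoc, mul_inv_cancel₀ (hγ n).ne', one_mul, ← neg_sub (x n) z,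
        inner_neg_right] at h2
      linarith
    have i3 : inner ℝ (y - p) (x n - z) ≤ δ * ‖x n - z‖ := by
      refine (real_inner_le_norm _ _).trans (mul_le_mul_of_nonneg_right ?_ (norm_nonneg _))
      rw [← dist_eq_norm, dist_comm]
      exact hyp.le
    -- The three terms are controlled by `quasiDom` and small `γ n`, by `y` being near `p`, and by
    -- the projection inequality.
    have i4 : a ^ 2 = inner ℝ (x n - y) (x n - z) + inner ℝ (y - p) (x n - z)
        + inner ℝ (z - p) (x n - p) := by
      rw [← inner_add_left, sub_add_sub_cancel, real_inner_comm (x n - p) (z - p),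
        ← inner_add_right, sub_add_sub_cancel, real_inner_self_eq_norm_sq]
    have i5 : ‖x n‖ ≤ a + ‖p‖ := by simpa using norm_add_le (x n - p) p
    have i6 : ‖x n - z‖ ≤ a + ‖z - p‖ := by
      simpa using norm_sub_le (x n - p) (z - p)
    have i7 : a ^ 2 ≤ δ * (1 + (a + ‖p‖)) + δ * (a + ‖z - p‖) := by
      have h1 : γ n * c * (1 + ‖x n‖) ≤ δ * (1 + (a + ‖p‖)) := by gcongr
      have h2 : δ * ‖x n - z‖ ≤ δ * (a + ‖z - p‖) := by gcongr
      linarith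
    have i8 : a ^ 2 ≤ 2 * δ * a + δ * K := by rw [hK]; linarith
    by_contra! hlt
    nlinarith [mul_le_mul_of_nonneg_right hδ1 ha0]
  refine ⟨p, ⟨mem_closure_of_tendsto hconv (Eventually.of_forall hdom), fun y hy => ?_⟩, hconv⟩
  rw [real_inner_comm]
  exact hp y (closure_mono hB.dom_subset_quasiDom hy)

-- For `c < d`, monotonicity forces `⟪x - y, z - x⟫ ≥ 0`; expand `‖(z - x) + (x - y)‖²`. The
-- increments of `‖z - x c‖²` thus control distances between resolvents.
omit [CompleteSpace G] in
theorem IsMonotone.norm_sub_sq_le_of_le {B : G → Set G} (hB : IsMonotone B) {c d : ℝ}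
    (hc : 0 < c) (hcd : c ≤ d) {z x y : G} (hx : c⁻¹ • (z - x) ∈ B x)
    (hy : d⁻¹ • (z - y) ∈ B y) : ‖x - y‖ ^ 2 ≤ ‖z - y‖ ^ 2 - ‖z - x‖ ^ 2 := by
  have h1 : 0 ≤ inner ℝ (x - y) (c⁻¹ • (z - x) - d⁻¹ • (z - y)) := hB (x, _) hx (y, _) hy
  have hd : 0 < d := hc.trans_le hcd
  have e1 : c⁻¹ • (z - x) - d⁻¹ • (z - y) = (c⁻¹ - d⁻¹) • (z - x) - d⁻¹ • (x - y) := by module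
  rw [e1, inner_sub_right, inner_smul_right, inner_smul_right, real_inner_self_eq_norm_sq] at h1
  have e2 : z - y = (z - x) + (x - y) := by abel
  have h2 := norm_add_sq_real (z - x) (x - y)
  rw [← e2, real_inner_comm] at h2
  rcases hcd.eq_or_lt with rfl | hlt
  · have : ‖x - y‖ ^ 2 ≤ 0 := by
      rw [sub_self, zero_mul, zero_sub, neg_nonneg] at h1
      exact nonpos_of_mul_nonpos_right h1 (inv_pos.mpr hc)
    have h3 : x - y = 0 := by simpa using this
    simp [e2, h3]
  · have h3 : 0 < c⁻¹ - d⁻¹ := sub_pos.mpr (inv_strictAnti₀ hc hlt)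
    have h4 : 0 ≤ d⁻¹ * ‖x - y‖ ^ 2 := by positivity
    have h5 : 0 ≤ inner ℝ (x - y) (z - x) := by
      refine nonneg_of_mul_nonneg_right (a := c⁻¹ - d⁻¹) ?_ h3
      linarith
    linarith

/-- Resolvents `(Id + γ B)⁻¹ z` converge to the projection of `z` onto `zer B` as `γ → ∞`. -/
theorem IsMaximallyMonotone.exists_tendsto_resolvent_atTop {B : G → Set G}
    (hB : IsMaximallyMonotone B) (hzer : (zer B).Nonempty) (z : G) {x : ℝ → G}
    (hx : ∀ c, 0 < c → c⁻¹ • (z - x c) ∈ B (x c)) :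
    ∃ p, z - p ∈ normalCone (zer B) p ∧ Tendsto x atTop (𝓝 p) := by
  have hq : ∀ q ∈ zer B, ∀ c, 0 < c → 0 ≤ inner ℝ (x c - q) (z - x c) := by
    intro q hq c hc
    have h1 : 0 ≤ inner ℝ (x c - q) (c⁻¹ • (z - x c) - 0) := hB.1 (x c, _) (hx c hc) (q, 0) hq
    rw [sub_zero, inner_smul_right] at h1
    exact nonneg_of_mul_nonneg_right h1 (inv_pos.mpr hc)
  -- Truncation at `1` keeps parameters positive on all of `ℝ`, so `a` is globally monotone; the
  -- limit at infinity is unaffected.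
  let m : ℝ → ℝ := fun c => max c 1
  have hm : ∀ c, 0 < m c := fun c => lt_max_of_lt_right one_pos
  let a : ℝ → ℝ := fun c => ‖z - x (m c)‖ ^ 2
  have hstep : ∀ c d, c ≤ d → ‖x (m c) - x (m d)‖ ^ 2 ≤ a d - a c := fun c d hcd =>
    hB.1.norm_sub_sq_le_of_le (hm c) (max_le_max_right 1 hcd) (hx _ (hm c)) (hx _ (hm d))
  have hmono : Monotone a := fun c d hcd => by nlinarith [hstep c d hcd]
  obtain ⟨q, hqz⟩ := hzer
  have hbdd : BddAbove (Set.range a) := by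
    refine ⟨‖z - q‖ ^ 2, ?_⟩
    rintro _ ⟨c, rfl⟩
    have h1 := hq q hqz _ (hm c)
    have h2 := norm_add_sq_real (z - x (m c)) (x (m c) - q)
    rw [sub_add_sub_cancel, real_inner_comm] at h2
    change ‖z - x (m c)‖ ^ 2 ≤ _
    nlinarith [sq_nonneg ‖x (m c) - q‖]
  have hcau : CauchySeq (fun c => x (m c)) := by
    have ha := (tendsto_atTop_ciSup hmono hbdd).cauchySeq
    rw [Metric.cauchySeq_iff'] at ha ⊢
    intro ε hε
    obtain ⟨N, hN⟩ := ha (ε ^ 2) (by positivity)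
    refine ⟨N, fun c hc => ?_⟩
    have h1 := hN c hc
    rw [Real.dist_eq] at h1
    have h2 := hstep N c hc
    rw [dist_comm, dist_eq_norm]
    exact lt_of_pow_lt_pow_left₀ 2 hε.le (h2.trans_lt ((le_abs_self _).trans_lt h1))
  obtain ⟨p, hp⟩ := cauchySeq_tendsto_of_complete hcau
  have hconv : Tendsto x atTop (𝓝 p) := by
    refine hp.congr' ?_
    filter_upwards [eventually_ge_atTop 1] with c hc
    simp only [m, max_eq_left hc]
  have hzp : Tendsto (fun c => z - x c) atTop (𝓝 (z - p)) := hconv.const_sub z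
  refine ⟨p, ⟨?_, fun r hr => ?_⟩, hconv⟩
  -- The elements `c⁻¹ • (z - x c)` of `B (x c)` tend to `0`, so `(p, 0)` is monotonically related
  -- to the graph.
  · refine hB.mem fun y v hv => ?_
    have h1 : Tendsto (fun c : ℝ => c⁻¹ • (z - x c)) atTop (𝓝 0) := by
      simpa using tendsto_inv_atTop_zero.smul hzp
    refine ge_of_tendsto ((hconv.sub_const y).inner (h1.sub_const v)) ?_
    filter_upwards [eventually_gt_atTop 0] with c hc
    exact hB.1 (x c, _) (hx c hc) (y, v) hv
  · have h1 : 0 ≤ inner ℝ (p - r) (z - p) := by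
      refine ge_of_tendsto ((hconv.sub_const r).inner hzp) ?_
      filter_upwards [eventually_gt_atTop 0] with c hc using hq r hr c hc
    rw [← neg_sub p r, inner_neg_left]
    linarith

end Asymptotics

/-! ### Assembly of the main theorem. -/

theorem IsMonotone.isResolvent_smul {G : Type*} [NormedAddCommGroup G] [InnerProductSpace ℝ G]
    {B : G → Set G} (hB : IsMonotone B) {c : ℝ} (hc : 0 < c) {J : G → G}
    (hJ : ∀ z, c⁻¹ • (z - J z) ∈ B (J z)) : IsResolvent (fun y => c • B y) J :=
  (hB.smul hc.le).isResolvent fun z => ⟨_, hJ z, by simp [smul_smul, hc.ne']⟩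

end SetValuedOp

theorem mainTheorem8 {H G : Type*}
    [NormedAddCommGroup H] [InnerProductSpace ℝ H] [CompleteSpace H]
    [NormedAddCommGroup G] [InnerProductSpace ℝ G] [CompleteSpace G]
    (Ln : ℕ → H →L[ℝ] G) (L : H →L[ℝ] G) (B : G → Set G) (γ : ℕ → ℝ)
    (hB : SetValuedOp.IsMaximallyMonotone B)
    (hγ : ∀ n, 0 < γ n)
    (hL : Tendsto Ln atTop (𝓝 L))
    (hLn : ∀ n, ‖Ln n‖ ≤ 1) :
    (Tendsto γ atTop (𝓝 0) →
      SetValuedOp.GraphConverges (fun n => SetValuedOp.resolventComp 1 (Ln n) (fun y => γ n • B y))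
        (SetValuedOp.resolventComp 1 L (SetValuedOp.normalCone (closure (SetValuedOp.dom B)))) ∧
      SetValuedOp.GraphConverges (fun n => SetValuedOp.resolventCocomp 1 (Ln n) (fun y => γ n • B y))
        (SetValuedOp.resolventCocomp 1 L (SetValuedOp.normalCone (closure (SetValuedOp.dom B))))) ∧
    (Tendsto γ atTop atTop → (SetValuedOp.zer B).Nonempty →
      SetValuedOp.GraphConverges (fun n => SetValuedOp.resolventComp 1 (Ln n) (fun y => γ n • B y))
        (SetValuedOp.resolventComp 1 L (SetValuedOp.normalCone (SetValuedOp.zer B))) ∧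
      SetValuedOp.GraphConverges (fun n => SetValuedOp.resolventCocomp 1 (Ln n) (fun y => γ n • B y))
        (SetValuedOp.resolventCocomp 1 L (SetValuedOp.normalCone (SetValuedOp.zer B)))) := by
  have hres : ∀ (c : ℝ) (z : G), ∃ x, 0 < c → c⁻¹ • (z - x) ∈ B x := fun c z => by
    by_cases hc : 0 < c
    · obtain ⟨x, hx⟩ := hB.exists_sub_mem hc z
      exact ⟨x, fun _ => hx⟩
    · exact ⟨0, fun h => absurd h hc⟩
  choose J hJ using hres
  have hM : ∀ n, SetValuedOp.IsMonotone (fun y => γ n • B y) := fun n => hB.1.smul (hγ n).le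
  have hR : ∀ n, SetValuedOp.IsResolvent (fun y => γ n • B y) (J (γ n)) := fun n =>
    hB.1.isResolvent_smul (hγ n) fun z => hJ _ z (hγ n)
  have main : ∀ C : Set G, (∀ z, ∃ p, z - p ∈ SetValuedOp.normalCone C p ∧
      Tendsto (fun n => J (γ n) z) atTop (𝓝 p)) →
      SetValuedOp.GraphConverges (fun n => SetValuedOp.resolventComp 1 (Ln n) (fun y => γ n • B y))
        (SetValuedOp.resolventComp 1 L (SetValuedOp.normalCone C)) ∧
      SetValuedOp.GraphConverges
        (fun n => SetValuedOp.resolventCocomp 1 (Ln n) (fun y => γ n • B y))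
        (SetValuedOp.resolventCocomp 1 L (SetValuedOp.normalCone C)) := by
    intro C hC
    choose P hP hlim using hC
    have hPR := (SetValuedOp.isMonotone_normalCone C).isResolvent hP
    exact ⟨SetValuedOp.graphConverges_resolventComp hL hM hR hPR hlim,
      SetValuedOp.graphConverges_resolventCocomp hL hM hR hPR hlim⟩
  refine ⟨fun h0 => main _ fun z => ?_, fun hinf hzer => main _ fun z => ?_⟩
  · exact hB.1.exists_tendsto_resolvent_zero hγ h0 z fun n => hJ _ z (hγ n)
  · obtain ⟨p, hp, hconv⟩ := hB.exists_tendsto_resolvent_atTop hzer z (x := fun c => J c z)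
      fun c hc => hJ c z hc
    exact ⟨p, hp, hconv.comp hinf⟩
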